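/- Let $\mathcal L$ be a propositional language over a finite set of atoms and let $K$ be a finite set of conditionals $A \mathrel{|\!\sim} B$ with $A,B\in\mathcal L$. *Models.* A preferential model $\langle W,<,v\rangle$ consists of a non-empty set $W$, an irreflexive transitive relation $<$ on $W$ and a valuation $v$, subject to smoothness: every world satisfying a formula $A$ is, or lies above, a $<$-minimal world satisfying $A$. It satisfies $A\mathrel{|\!\sim}B$ if $B$ holds at all $<$-minimal worlds satisfying $A$. It is ranked if $<$ is modular ($x<y$ implies $x<z$ or $z<y$). $K$ is satisfiable if it has a preferential model, and $K\models c$ means that every preferential model of $K$ satisfies $c$. In a finite model, the rank of a world is the length of a longest chain $w_0<\dots<w$ from a minimal world $w_0$ to it. *Ranks of formulas.* A formula $A$ is exceptional for a set $C$ of conditionals if $C\models\top\mathrel{|\!\sim}\neg A$. Put $C_0=K$ and let $C_{i+1}$ be the set of conditionals of $C_i$ whose antecedent is exceptional for $C_i$. Then $\mathrm{rank}(A)$ is the least $i$ such that $A$ is not exceptional for $C_i$, and $\infty$ if there is none; the rank of a conditional is that of its antecedent; the order $k$ of $K$ is the least $i$ with $C_i\setminus C_{i+1}=\emptyset$. *MP-closure.*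 For $D\subseteq K$ let $D_r$ be the set of conditionals in $D$ of rank $r$. Write $D\prec^{MP}B$ if $\langle D_\infty,D_k,\dots,D_0\rangle$ precedes $\langle B_\infty,B_k,\dots,B_0\rangle$ lexicographically, components being compared by strict inclusion. For $A$ of finite rank, an MP-basis for $A$ is a set $D\subseteq K$ whose set $\tilde D$ of material implications is consistent with $A$ and which is $\prec^{MP}$-maximal with this property. $\mathcal{MP}_K$ is the set of conditionals $A\mathrel{|\!\sim}B$ over $\mathcal L$ such that $\tilde D\cup\{A\}\models B$ for all MP-bases $D$ for $A$ (in particular all those with $\mathrm{rank}(A)=\infty$). *MP-models.* A truth assignment is compatible with $K$ if it makes true no $A\in\mathcal L$ with $K\models A\mathrel{|\!\sim}\bot$. A ranked model of $K$ is canonical if every assignment compatible with $K$ is realized, on $\mathcal L$, at some world. $Min_{RC}(K)$ is the set of finite canonical ranked models $\langle W,<,v\rangle$ of $K$ for which no canonical ranked model of $K$ with the same $W$ and $v$ gives every world a rank at most as large and some world a smaller one. An MP-model of $K$ is a structure $\langle W,<',v\rangle$ where $\langle W,<,v\rangle\in Min_{RC}(K)$ for some $<$, and $x<'y$ iff $V(x)\prec^{MP}V(y)$,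 with $V(z)$ the set of conditionals $A\mathrel{|\!\sim}C$ in $K$ such that $A\wedge\neg C$ holds at $z$. For an MP-model $\mathcal N=\langle W,<',v\rangle$, let $\mathcal N^R=\langle W,<^R,v\rangle$, where $x<^R y$ iff the length of a longest $<'$-chain from a $<'$-minimal world to $x$ is smaller than the length of a longest such chain to $y$. **Proposition.** Let $K$ be satisfiable. Then $K$ has an MP-model; for every MP-model $\mathcal N_{MP}$ of $K$, $\mathcal N_{MP}^R$ is a ranked model, and the set $\mathcal{MP}_K^R$ of conditionals over $\mathcal L$ satisfied by $\mathcal N_{MP}^R$ does not depend on the choice of $\mathcal N_{MP}$ and is a rational consequence relation on $\mathcal L$ (it satisfies Left Logical Equivalence, Right Weakening, Reflexivity, And, Or, Cautious Monotonicity and Rational Monotonicity). Moreover $$\mathcal{MP}_K\subseteq\mathcal{MP}_K^R .$$ There is a finite satisfiable $K$ over a finite language for which this inclusion is strict. -/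

import Mathlib

universe u

namespace KLM

/-! ### Propositional language -/

/-- Propositional formulas over a set of atoms. -/
inductive Formula (Atom : Type u) : Type u
  | atom (p : Atom) : Formula Atom
  | bot : Formula Atom
  | neg (A : Formula Atom) : Formula Atom
  | and (A B : Formula Atom) : Formula Atom
  | or (A B : Formula Atom) : Formula Atom
  | imp (A B : Formula Atom) : Formula Atom

namespace Formula

variable {Atom : Type u}

/-- The constant "true". -/
def top : Formula Atom := neg bot

/-- Truth of a formula under the assignment making exactly the atoms in `s` true. -/
def Holds (s : Set Atom) : Formula Atom → Prop
  | atom p => p ∈ s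
  | bot => False
  | neg A => ¬ Holds s A
  | and A B => Holds s A ∧ Holds s B
  | or A B => Holds s A ∨ Holds s B
  | imp A B => Holds s A → Holds s B

/-- The atoms occurring in a formula. -/
def atoms : Formula Atom → Set Atom
  | atom p => {p}
  | bot => ∅
  | neg A => atoms A
  | and A B => atoms A ∪ atoms B
  | or A B => atoms A ∪ atoms B
  | imp A B => atoms A ∪ atoms B

/-- Propositional validity. -/
def Valid (A : Formula Atom) : Prop := ∀ s : Set Atom, A.Holds s

end Formula

open Formula

/-- A conditional assertion (default) `A |~ B`. -/
structure Conditional (Atom : Type u) : Type u where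
  ante : Formula Atom
  cons : Formula Atom

section

variable {Atom : Type u}

/-- The formulas all of whose atoms lie in `S`. -/
def Lang (S : Set Atom) : Set (Formula Atom) := {A | A.atoms ⊆ S}

/-- The conditionals over the language with atoms `S`. -/
def CondLang (S : Set Atom) : Set (Conditional Atom) := {c | c.ante ∈ Lang S ∧ c.cons ∈ Lang S}

/-- A set of formulas is consistent in the propositional calculus. -/
def Consistent (Γ : Set (Formula Atom)) : Prop := ∃ s : Set Atom, ∀ A ∈ Γ, A.Holds s

/-- Logical consequence in the propositional calculus. -/
def Entails (Γ : Set (Formula Atom)) (B : Formula Atom) : Prop :=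
  ∀ s : Set Atom, (∀ A ∈ Γ, A.Holds s) → B.Holds s

/-- The material counterpart of a set of conditionals. -/
def material (D : Set (Conditional Atom)) : Set (Formula Atom) :=
  (fun c => Formula.imp c.ante c.cons) '' D

end

/-! ### Preferential and ranked models -/

/-- An interpretation with set of worlds `W`: a relation on worlds and a valuation. -/
structure Interp (W Atom : Type u) where
  lt : W → W → Prop
  v : W → Set Atom

namespace Interp

variable {W Atom : Type u}

/-- Truth of a formula at a world. -/
def Sat (M : Interp W Atom) (w : W) (A : Formula Atom) : Prop := A.Holds (M.v w)

/-- The minimal worlds satisfying `A`. -/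
def Min (M : Interp W Atom) (A : Formula Atom) : Set W :=
  {w | M.Sat w A ∧ ∀ w', M.lt w' w → ¬ M.Sat w' A}

/-- Satisfaction of a conditional. -/
def Satisfies (M : Interp W Atom) (c : Conditional Atom) : Prop :=
  ∀ w ∈ M.Min c.ante, M.Sat w c.cons

/-- Satisfaction of a knowledge base. -/
def Models (M : Interp W Atom) (K : Set (Conditional Atom)) : Prop := ∀ c ∈ K, M.Satisfies c

/-- Preferential models: nonempty, irreflexive, transitive, smooth. -/
structure IsPreferential (M : Interp W Atom) : Prop where
  nonempty : Nonempty W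
  irrefl : ∀ x, ¬ M.lt x x
  trans : ∀ x y z, M.lt x y → M.lt y z → M.lt x z
  smooth : ∀ (A : Formula Atom) (w : W), M.Sat w A →
    w ∈ M.Min A ∨ ∃ w' ∈ M.Min A, M.lt w' w

/-- Ranked models: preferential models with a modular relation. -/
structure IsRanked (M : Interp W Atom) : Prop extends M.IsPreferential where
  modular : ∀ x y z, M.lt x y → M.lt x z ∨ M.lt z y

/-- `n` is the length of some chain `w₀ < w₁ < ⋯ < wₙ = w` from a minimal world `w₀` to `w`. -/
def IsChainLength (M : Interp W Atom) (w : W) (n : ℕ) : Prop :=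
  ∃ c : ℕ → W, (∀ z, ¬ M.lt z (c 0)) ∧ (∀ i < n, M.lt (c i) (c (i + 1))) ∧ c n = w

/-- The rank (height) of a world: the length of a longest chain from a minimal world to it.
It is only used for finite strict partial orders, where chain lengths are bounded and
chains exist. -/
noncomputable def worldRank (M : Interp W Atom) (w : W) : ℕ := sSup {n | M.IsChainLength w n}

/-- The interpretation with the same worlds and valuation, ordered by the rank of worlds. -/
noncomputable def rankify (N : Interp W Atom) : Interp W Atom where
  lt x y := N.worldRank x < N.worldRank y
  v := N.v

/-- `M` is preferred to `M'` in the fixed interpretations minimal semantics. -/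
def FIMS (M M' : Interp W Atom) : Prop :=
  M.v = M'.v ∧ (∀ x, M.worldRank x ≤ M'.worldRank x) ∧ ∃ x, M.worldRank x < M'.worldRank x

end Interp

section

variable {Atom : Type u}

/-- `K` is satisfiable: it has a preferential model. -/
def Satisfiable (K : Set (Conditional Atom)) : Prop :=
  ∃ (W : Type u) (M : Interp W Atom), M.IsPreferential ∧ M.Models K

/-- Preferential entailment. -/
def PrefEntails (K : Set (Conditional Atom)) (c : Conditional Atom) : Prop :=
  ∀ (W : Type u) (M : Interp W Atom), M.IsPreferential → M.Models K → M.Satisfies c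

/-! ### Ranks in the rational closure -/

/-- `A` is exceptional for `K`. -/
def Exceptional (K : Set (Conditional Atom)) (A : Formula Atom) : Prop :=
  PrefEntails K ⟨Formula.top, Formula.neg A⟩

/-- The sequence `C₀ = K`, `Cᵢ₊₁ = E(Cᵢ)`, where `E(C)` consists of the conditionals of `C`
whose antecedent is exceptional for `C`. -/
def excSeq (K : Set (Conditional Atom)) : ℕ → Set (Conditional Atom)
  | 0 => K
  | i + 1 => {c | c ∈ excSeq K i ∧ Exceptional (excSeq K i) c.ante}

/-- The rank of a formula: the least `i` such that it is not exceptional for `Cᵢ`,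
and `⊤` if there is none. -/
noncomputable def rank (K : Set (Conditional Atom)) (A : Formula Atom) : ℕ∞ :=
  sInf ((fun i : ℕ => (i : ℕ∞)) '' {i | ¬ Exceptional (excSeq K i) A})

/-- The order of `K`: the least `i` such that no default has rank `i`. -/
noncomputable def order (K : Set (Conditional Atom)) : ℕ :=
  sInf {i | excSeq K i \ excSeq K (i + 1) = ∅}

/-! ### The MP-closure -/

/-- The defaults in `D` of rank `r` (w.r.t. `K`). -/
def layer (K D : Set (Conditional Atom)) (r : ℕ∞) : Set (Conditional Atom) :=
  {c | c ∈ D ∧ rank K c.ante = r}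

/-- The lexicographic order `⟨Xₙ, …, X₀⟩ ≪ ⟨Yₙ, …, Y₀⟩` on tuples of sets. -/
def TupleLT {α : Type u} (X Y : ℕ → Set α) : ℕ → Prop
  | 0 => X 0 ⊂ Y 0
  | n + 1 => X (n + 1) ⊂ Y (n + 1) ∨ (X (n + 1) = Y (n + 1) ∧ TupleLT X Y n)

/-- The MP-seriousness ordering: `⟨D_∞, D_k, …, D₀⟩ ≪ ⟨B_∞, B_k, …, B₀⟩`, `k` the order of `K`. -/
def MPLT (K D B : Set (Conditional Atom)) : Prop :=
  layer K D ⊤ ⊂ layer K B ⊤ ∨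
    (layer K D ⊤ = layer K B ⊤ ∧
      TupleLT (fun i => layer K D (i : ℕ∞)) (fun i => layer K B (i : ℕ∞)) (order K))

/-- `D` is an MP-basis for `A` (a formula of finite rank). -/
def IsMPBasis (K : Set (Conditional Atom)) (A : Formula Atom) (D : Set (Conditional Atom)) :
    Prop :=
  rank K A ≠ ⊤ ∧ D ⊆ K ∧ Consistent (insert A (material D)) ∧
    ¬ ∃ B ⊆ K, Consistent (insert A (material B)) ∧ MPLT K D B

/-- The MP-closure of `K`, in the language with atoms `S`. -/
def mpClosure (K : Set (Conditional Atom)) (S : Set Atom) : Set (Conditional Atom) :=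
  {c | c ∈ CondLang S ∧
    ∀ D, IsMPBasis K c.ante D → Entails (insert c.ante (material D)) c.cons}

/-! ### Minimal canonical models and MP-models -/

/-- The truth assignment `s`, restricted to the atoms in `S`, is compatible with `K`. Only
formulas over `S` are evaluated, so the membership in `s` of other atoms is irrelevant. -/
def Compatible (K : Set (Conditional Atom)) (S s : Set Atom) : Prop :=
  ¬ ∃ A ∈ Lang S, A.Holds s ∧ PrefEntails K ⟨A, Formula.bot⟩

variable {W : Type u}

/-- Every assignment to the atoms in `S` that is compatible with `K` is realized at a world. -/
def IsCanonical (K : Set (Conditional Atom)) (S : Set Atom) (M : Interp W Atom) : Prop :=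
  ∀ s : Set Atom, Compatible K S s → ∃ w : W, ∀ B ∈ Lang S, M.Sat w B ↔ B.Holds s

/-- Canonical ranked models of `K` with respect to the language with atoms `S`. -/
def IsCanonicalRanked (K : Set (Conditional Atom)) (S : Set Atom) (M : Interp W Atom) : Prop :=
  M.IsRanked ∧ M.Models K ∧ IsCanonical K S M

/-- Finite minimal canonical ranked models of `K` with respect to the language with atoms `S`. -/
def IsMinRC (K : Set (Conditional Atom)) (S : Set Atom) (M : Interp W Atom) : Prop :=
  Finite W ∧ IsCanonicalRanked K S M ∧
    ¬ ∃ M' : Interp W Atom, IsCanonicalRanked K S M' ∧ M'.FIMS M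

/-- The defaults of `K` violated at a world. -/
def violated (K : Set (Conditional Atom)) (M : Interp W Atom) (w : W) : Set (Conditional Atom) :=
  {c | c ∈ K ∧ M.Sat w (Formula.and c.ante (Formula.neg c.cons))}

/-- Worlds compared by the MP-seriousness of the sets of defaults which they violate. -/
def mpFunctor (K : Set (Conditional Atom)) (M : Interp W Atom) : Interp W Atom where
  lt x y := MPLT K (violated K M x) (violated K M y)
  v := M.v

/-- MP-models of `K` (with respect to the language with atoms `S`). -/
def IsMPModel (K : Set (Conditional Atom)) (S : Set Atom) (N : Interp W Atom) : Prop :=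
  ∃ M : Interp W Atom, IsMinRC K S M ∧ N = mpFunctor K M

/-- The consequence relation, on the language with atoms `S`, defined by a model. -/
def conseqRel (S : Set Atom) (M : Interp W Atom) : Set (Conditional Atom) :=
  {c | c ∈ CondLang S ∧ M.Satisfies c}

/-- The consequence relation defined by the ranked model obtained from an MP-model `N`. -/
noncomputable def mpRational (S : Set Atom) (N : Interp W Atom) : Set (Conditional Atom) :=
  conseqRel S N.rankify

/-- Rational consequence relations on the language with atoms `S`. -/
structure IsRationalRel (S : Set Atom) (R : Set (Conditional Atom)) : Prop where
  subset_lang : R ⊆ CondLang S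
  leftLogicalEquivalence : ∀ A ∈ Lang S, ∀ B ∈ Lang S, ∀ C ∈ Lang S,
    Valid (.and (.imp A B) (.imp B A)) → ⟨A, C⟩ ∈ R → ⟨B, C⟩ ∈ R
  rightWeakening : ∀ A ∈ Lang S, ∀ B ∈ Lang S, ∀ C ∈ Lang S,
    Valid (.imp B C) → ⟨A, B⟩ ∈ R → ⟨A, C⟩ ∈ R
  reflexivity : ∀ A ∈ Lang S, ⟨A, A⟩ ∈ R
  andRule : ∀ A ∈ Lang S, ∀ B ∈ Lang S, ∀ C ∈ Lang S,
    ⟨A, B⟩ ∈ R → ⟨A, C⟩ ∈ R → ⟨A, .and B C⟩ ∈ R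
  orRule : ∀ A ∈ Lang S, ∀ B ∈ Lang S, ∀ C ∈ Lang S,
    ⟨A, C⟩ ∈ R → ⟨B, C⟩ ∈ R → ⟨.or A B, C⟩ ∈ R
  cautiousMonotonicity : ∀ A ∈ Lang S, ∀ B ∈ Lang S, ∀ C ∈ Lang S,
    ⟨A, B⟩ ∈ R → ⟨A, C⟩ ∈ R → ⟨.and A B, C⟩ ∈ R
  rationalMonotonicity : ∀ A ∈ Lang S, ∀ B ∈ Lang S, ∀ C ∈ Lang S,
    ⟨A, C⟩ ∈ R → ⟨A, .neg B⟩ ∉ R → ⟨.and A B, C⟩ ∈ R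

end

end KLM

/-! Everything rests on identifying the compatible assignments: they are exactly those satisfying
the material counterpart of some `excSeq K i` (`Compatible.exists_satMaterial`,
`compatible_of_satMaterial`). For large `i` that set contains only defaults of infinite rank, whose
antecedents are false in every model; conversely, the finite-rank assignments over `S`, ordered by
rank, form a canonical ranked model (`rankModel`). As there are finitely many of them, minimizing
the sum of world ranks yields an MP-model. The order of an MP-model depends only on the formulas
over `S` true at the worlds, and any two canonical models realize the same theories over `S`. Chains
therefore transfer between MP-models, heights agree, and so do the induced relations. These are
rational because they come from ranked models. For the inclusion, let `w` be an `A`-world of least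
height. The defaults not violated at `w` form an MP-basis for `A`: a more serious set consistent
with `A` would contain all defaults of infinite rank, hence be satisfied at some world `x`.
Complementation reverses seriousness, so `x` would lie strictly below `w`. For strictness, take
three independent atoms that are normally true. Violating the first default and violating the other
two are incomparable under inclusion, but the heights are 1 and 2. -/

namespace KLM

open Formula

section

variable {Atom : Type u}

/-! ### Propositional preliminaries -/

/-- The assignment `s` satisfies the material counterparts of the conditionals in `C`. -/
def SatMaterial (s : Set Atom) (C : Set (Conditional Atom)) : Prop :=
  ∀ c ∈ C, c.ante.Holds s → c.cons.Holds s

theorem satMaterial_iff_material {s : Set Atom} {C : Set (Conditional Atom)} :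
    SatMaterial s C ↔ ∀ A ∈ material C, A.Holds s := by
  simp [SatMaterial, material, Holds]

theorem SatMaterial.mono {s : Set Atom} {C D : Set (Conditional Atom)} (h : SatMaterial s C)
    (hDC : D ⊆ C) : SatMaterial s D := fun c hc => h c (hDC hc)

theorem holds_inter_iff {S s : Set Atom} {A : Formula Atom} (hA : A ∈ Lang S) :
    A.Holds (s ∩ S) ↔ A.Holds s := by
  induction A with
  | atom p =>
    have : p ∈ S := hA rfl
    simp [Holds, this]
  | bot => rfl
  | neg A ih => exact not_congr (ih hA)
  | and A B ihA ihB =>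
    exact and_congr (ihA (Set.union_subset_iff.1 hA).1) (ihB (Set.union_subset_iff.1 hA).2)
  | or A B ihA ihB =>
    exact or_congr (ihA (Set.union_subset_iff.1 hA).1) (ihB (Set.union_subset_iff.1 hA).2)
  | imp A B ihA ihB =>
    exact imp_congr (ihA (Set.union_subset_iff.1 hA).1) (ihB (Set.union_subset_iff.1 hA).2)

theorem satMaterial_congr {S s t : Set Atom} {C : Set (Conditional Atom)} (hC : C ⊆ CondLang S)
    (h : ∀ B ∈ Lang S, B.Holds s ↔ B.Holds t) : SatMaterial s C ↔ SatMaterial t C :=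
  forall₂_congr fun _ hc => imp_congr (h _ (hC hc).1) (h _ (hC hc).2)

/-- Finite sets of conditionals have a disjunction of their antecedents. -/
theorem exists_holds_iff_exists_ante {C : Set (Conditional Atom)} (hC : C.Finite) :
    ∃ F : Formula Atom, ∀ s, F.Holds s ↔ ∃ c ∈ C, c.ante.Holds s := by
  induction C, hC using Set.Finite.induction_on with
  | empty => exact ⟨.bot, fun s => by simp [Holds]⟩
  | @insert c C _ _ ih =>
    obtain ⟨F, hF⟩ := ih
    exact ⟨.or c.ante F, fun s => by simp [Holds, hF]⟩

/-! ### Models given by ranking functions -/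

/-- Smoothness holds because a function to `ℕ` attains a minimum on every nonempty set of worlds. -/
theorem Interp.isRanked_of_lt_iff {W : Type u} [hW : Nonempty W] {M : Interp W Atom} (f : W → ℕ)
    (hf : ∀ x y, M.lt x y ↔ f x < f y) : M.IsRanked where
  nonempty := hW
  irrefl x := by simp [hf]
  trans x y z := by simp only [hf]; exact lt_trans
  modular x y z := by simp only [hf]; omega
  smooth A w hw := by
    obtain ⟨m, hm, hmin⟩ := (measure f).wf.has_min {w | M.Sat w A} ⟨w, hw⟩
    have hmMin : m ∈ M.Min A := ⟨hm, fun w' hlt hw' => hmin w' hw' ((hf _ _).1 hlt)⟩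
    rcases lt_or_ge (f m) (f w) with h | h
    · exact Or.inr ⟨m, hmMin, (hf _ _).2 h⟩
    · refine Or.inl ⟨hw, fun w' hlt hw' => hmin w' hw' ?_⟩
      exact lt_of_lt_of_le ((hf _ _).1 hlt) h

theorem Interp.IsPreferential.exists_min {W : Type u} {M : Interp W Atom} (hM : M.IsPreferential)
    {A : Formula Atom} {w : W} (hw : M.Sat w A) : ∃ w', w' ∈ M.Min A := by
  rcases hM.smooth A w hw with h | ⟨w', h, -⟩
  exacts [⟨w, h⟩, ⟨w', h⟩]

/-- Exceptionality is inconsistency with the material counterpart. -/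
theorem not_exceptional_iff {C : Set (Conditional Atom)} {A : Formula Atom} :
    ¬ Exceptional C A ↔ ∃ s, SatMaterial s C ∧ A.Holds s := by
  constructor
  · intro h
    simp only [Exceptional, PrefEntails, not_forall] at h
    obtain ⟨W, M, -, hC, h⟩ := h
    simp only [Interp.Satisfies, not_forall] at h
    obtain ⟨w, hw, h⟩ := h
    -- A minimal `top`-world has nothing below it, so it is minimal for every antecedent it
    -- satisfies.
    refine ⟨M.v w, fun c hc hA => hC c hc w ⟨hA, fun w' hlt _ => ?_⟩, not_not.1 h⟩
    exact hw.2 w' hlt (by simp [Interp.Sat, top, Holds])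
  · rintro ⟨s, hs, hA⟩ h
    let M : Interp PUnit.{u + 1} Atom := ⟨fun _ _ => False, fun _ => s⟩
    have hM : M.IsRanked := Interp.isRanked_of_lt_iff (fun _ => 0) fun _ _ => by simp [M]
    exact h _ M hM.toIsPreferential (fun c hc w hw => hs c hc hw.1) PUnit.unit
      ⟨by simp [Interp.Sat, top, Holds], fun _ h => h.elim⟩ hA

/-! ### The sequence of exceptional conditionals -/

theorem excSeq_antitone (K : Set (Conditional Atom)) : Antitone (excSeq K) :=
  antitone_nat_of_succ_le fun _ _ hc => hc.1

theorem excSeq_subset (K : Set (Conditional Atom)) (i : ℕ) : excSeq K i ⊆ K :=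
  excSeq_antitone K (Nat.zero_le i)

theorem exists_excSeq_stable {K : Set (Conditional Atom)} (hK : K.Finite) :
    ∃ n, ∀ m, n ≤ m → excSeq K m = excSeq K n := by
  obtain ⟨n, -, hn⟩ := (measure fun i => (excSeq K i).ncard).wf.has_min Set.univ ⟨0, trivial⟩
  refine ⟨n, fun m hm => ?_⟩
  exact Set.eq_of_subset_of_ncard_le (excSeq_antitone K hm) (not_lt.1 (hn m trivial))
    (hK.subset (excSeq_subset K n))

theorem rank_eq_top_iff {K : Set (Conditional Atom)} {A : Formula Atom} :
    rank K A = ⊤ ↔ ∀ i, Exceptional (excSeq K i) A := by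
  simp [rank, sInf_eq_top]

theorem rank_ne_top {K : Set (Conditional Atom)} {A : Formula Atom} {s : Set Atom} {i : ℕ}
    (hs : SatMaterial s (excSeq K i)) (hA : A.Holds s) : rank K A ≠ ⊤ := fun h =>
  not_exceptional_iff.2 ⟨s, hs, hA⟩ (rank_eq_top_iff.1 h i)

theorem mem_excSeq_of_rank_eq_top {K : Set (Conditional Atom)} {c : Conditional Atom} (hc : c ∈ K)
    (h : rank K c.ante = ⊤) (i : ℕ) : c ∈ excSeq K i := by
  induction i with
  | zero => exact hc
  | succ i ih => exact ⟨ih, rank_eq_top_iff.1 h i⟩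

/-- Once the sequence is stable, its members belong to every stage, so their antecedents are
exceptional at every stage. -/
theorem exists_excSeq_subset_layer_top {K : Set (Conditional Atom)} (hK : K.Finite) :
    ∃ n, excSeq K n ⊆ layer K K ⊤ := by
  obtain ⟨n, hn⟩ := exists_excSeq_stable hK
  refine ⟨n, fun c hc => ⟨excSeq_subset K n hc, rank_eq_top_iff.2 fun i => ?_⟩⟩
  have : c ∈ excSeq K (i + 1) := by
    rcases le_total n (i + 1) with h | h
    · rwa [hn _ h]
    · exact excSeq_antitone K h hc
  exact this.2

/-- Antecedents of infinite rank hold at no world of a model. -/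
theorem prefEntails_bot_of_rank_eq_top {K : Set (Conditional Atom)} (hK : K.Finite)
    {c : Conditional Atom} (hc : c ∈ K) (h : rank K c.ante = ⊤) : PrefEntails K ⟨c.ante, .bot⟩ := by
  intro W M hM hMK w hw
  obtain ⟨n, hn⟩ := exists_excSeq_subset_layer_top hK
  obtain ⟨F, hF⟩ := exists_holds_iff_exists_ante (hK.subset (excSeq_subset K n))
  -- A minimal world for the disjunction `F` of the antecedents in `excSeq K n` is minimal for each
  -- of those antecedents it satisfies. It thus satisfies the material counterpart of `excSeq K n`,
  -- which gives its true antecedents finite rank.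
  have hwF : M.Sat w F := (hF _).2 ⟨c, mem_excSeq_of_rank_eq_top hc h n, hw.1⟩
  obtain ⟨m, hm, hmin⟩ := hM.exists_min hwF
  obtain ⟨d, hd, hdm⟩ := (hF _).1 hm
  refine absurd (hn hd).2 (rank_ne_top (s := M.v m) (i := n) (fun e he hem => ?_) hdm)
  exact hMK e (excSeq_subset K n he) m
    ⟨hem, fun w' hlt hw' => hmin w' hlt ((hF _).2 ⟨e, he, hw'⟩)⟩

/-! ### Compatible assignments -/

/-- Every world of a model carries a compatible assignment. -/
theorem compatible_v {K : Set (Conditional Atom)} {S : Set Atom} {W : Type u} {M : Interp W Atom}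
    (hM : M.IsPreferential) (hMK : M.Models K) (w : W) : Compatible K S (M.v w) := by
  rintro ⟨A, -, hA, h⟩
  obtain ⟨m, hm⟩ := hM.exists_min (w := w) hA
  exact h W M hM hMK m hm

/-- A late stage contains only defaults of infinite rank; a compatible assignment falsifies their
antecedents, so it satisfies that stage vacuously. -/
theorem Compatible.exists_satMaterial {K : Set (Conditional Atom)} {S s : Set Atom}
    (hK : K.Finite) (hKS : K ⊆ CondLang S) (hs : Compatible K S s) :
    ∃ i, SatMaterial s (excSeq K i) := by
  obtain ⟨n, hn⟩ := exists_excSeq_subset_layer_top hK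
  refine ⟨n, fun c hc hA => (hs ⟨c.ante, (hKS (hn hc).1).1, hA, ?_⟩).elim⟩
  exact prefEntails_bot_of_rank_eq_top hK (hn hc).1 (hn hc).2

/-- The assignments to the atoms in `S` that have finite rank. -/
def FiniteRankAssignment (K : Set (Conditional Atom)) (S : Set Atom) : Type u :=
  {s : Set Atom // s ⊆ S ∧ ∃ i, SatMaterial s (excSeq K i)}

open Classical in
/-- The assignments of finite rank, ordered by their ranks. -/
noncomputable def rankModel (K : Set (Conditional Atom)) (S : Set Atom) :
    Interp (FiniteRankAssignment K S) Atom where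
  lt x y := Nat.find x.2.2 < Nat.find y.2.2
  v x := x.1

theorem exists_finiteRankAssignment {K : Set (Conditional Atom)} {S s : Set Atom} {i : ℕ}
    (hKS : K ⊆ CondLang S) (hs : SatMaterial s (excSeq K i)) :
    ∃ x : FiniteRankAssignment K S, SatMaterial x.1 (excSeq K i) ∧
      ∀ B ∈ Lang S, B.Holds x.1 ↔ B.Holds s := by
  have h : ∀ B ∈ Lang S, B.Holds (s ∩ S) ↔ B.Holds s := fun B hB => holds_inter_iff hB
  have hs' := (satMaterial_congr ((excSeq_subset K i).trans hKS) h).2 hs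
  exact ⟨⟨s ∩ S, Set.inter_subset_right, i, hs'⟩, hs', h⟩

/-- A world violating `c` has rank at least the first stage without `c`. When `c` is dropped, its
antecedent is not exceptional for the preceding stage `j`, which provides an assignment of rank at
most `j` satisfying it. So no violating world is minimal for the antecedent. -/
theorem rankModel_models {K : Set (Conditional Atom)} {S : Set Atom} (hKS : K ⊆ CondLang S) :
    (rankModel K S).Models K := by
  classical
  intro c hc w hw
  by_contra hcons
  let p : ℕ → Prop := fun i => c ∉ excSeq K i
  have hp : p (Nat.find w.2.2) := fun h => hcons (Nat.find_spec w.2.2 c h hw.1)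
  have hex : ∃ i, p i := ⟨_, hp⟩
  obtain ⟨j, hj⟩ : ∃ j, Nat.find hex = j + 1 :=
    Nat.exists_eq_succ_of_ne_zero fun h => by
      have := Nat.find_spec hex
      rw [h] at this
      exact this hc
  have hcj : c ∈ excSeq K j := not_not.1 (Nat.find_min hex (by omega))
  have hcj' : c ∉ excSeq K (j + 1) := by simpa only [hj] using Nat.find_spec hex
  obtain ⟨s, hs, hA⟩ := not_exceptional_iff.1 fun h => hcj' ⟨hcj, h⟩
  obtain ⟨x, hx, hxs⟩ := exists_finiteRankAssignment hKS hs
  refine hw.2 x ?_ ((hxs _ (hKS hc).1).2 hA)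
  have h₁ : Nat.find x.2.2 ≤ j := Nat.find_min' _ hx
  have h₂ : Nat.find hex ≤ Nat.find w.2.2 := Nat.find_min' _ hp
  change Nat.find x.2.2 < Nat.find w.2.2
  omega

theorem rankModel_isRanked {K : Set (Conditional Atom)} {S : Set Atom}
    [Nonempty (FiniteRankAssignment K S)] : (rankModel K S).IsRanked := by
  classical
  exact Interp.isRanked_of_lt_iff (fun x => Nat.find x.2.2) fun _ _ => by
    simp only [rankModel]

/-- Assignments of finite rank are compatible. -/
theorem compatible_of_satMaterial {K : Set (Conditional Atom)} {S s : Set Atom} {i : ℕ}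
    (hKS : K ⊆ CondLang S) (hs : SatMaterial s (excSeq K i)) : Compatible K S s := by
  obtain ⟨x, -, hx⟩ := exists_finiteRankAssignment hKS hs
  have : Nonempty (FiniteRankAssignment K S) := ⟨x⟩
  rintro ⟨A, hA, hAs, h⟩
  exact compatible_v (S := S) rankModel_isRanked.toIsPreferential (rankModel_models hKS) x
    ⟨A, hA, (hx A hA).2 hAs, h⟩

theorem rankModel_isCanonicalRanked {K : Set (Conditional Atom)} {S : Set Atom} (hK : K.Finite)
    (hKS : K ⊆ CondLang S) (hsat : Satisfiable K) : IsCanonicalRanked K S (rankModel K S) := by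
  obtain ⟨W, M, hM, hMK⟩ := hsat
  obtain ⟨w⟩ := hM.nonempty
  obtain ⟨i, hi⟩ := (compatible_v (S := S) hM hMK w).exists_satMaterial hK hKS
  have : Nonempty (FiniteRankAssignment K S) := ⟨(exists_finiteRankAssignment hKS hi).choose⟩
  refine ⟨rankModel_isRanked, rankModel_models hKS, fun s hs => ?_⟩
  obtain ⟨i, hi⟩ := hs.exists_satMaterial hK hKS
  obtain ⟨x, -, hx⟩ := exists_finiteRankAssignment hKS hi
  exact ⟨x, hx⟩

theorem exists_isMPModel {K : Set (Conditional Atom)} {S : Set Atom} (hS : S.Finite)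
    (hK : K.Finite) (hKS : K ⊆ CondLang S) (hsat : Satisfiable K) :
    ∃ (W : Type u) (N : Interp W Atom), IsMPModel K S N := by
  have hfin : Finite (FiniteRankAssignment K S) :=
    Set.Finite.to_subtype (s := {s | s ⊆ S ∧ ∃ i, SatMaterial s (excSeq K i)})
      (hS.finite_subsets.subset fun _ h => h.1)
  have := Fintype.ofFinite (FiniteRankAssignment K S)
  obtain ⟨M, hM, hmin⟩ :=
    -- An interpretation preferred in the sense of `FIMS` has a strictly smaller sum of world ranks,
    -- so a minimizer of the sum is minimal.
    (measure fun M : Interp (FiniteRankAssignment K S) Atom => ∑ x, M.worldRank x).wf.has_min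
      {M | IsCanonicalRanked K S M} ⟨_, rankModel_isCanonicalRanked hK hKS hsat⟩
  refine ⟨_, _, M, ⟨hfin, hM, ?_⟩, rfl⟩
  rintro ⟨M', hM', -, hle, x, hx⟩
  exact hmin M' hM' (Finset.sum_lt_sum (fun x _ => hle x) ⟨x, Finset.mem_univ x, hx⟩)

/-! ### Ranks of worlds in finite strict orders -/

theorem Interp.IsChainLength.succ {W : Type u} {M : Interp W Atom} {x y : W} {n : ℕ}
    (h : M.IsChainLength x n) (hxy : M.lt x y) : M.IsChainLength y (n + 1) := by
  obtain ⟨c, h0, hc, rfl⟩ := h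
  refine ⟨fun i => if i ≤ n then c i else y, by simpa using h0, fun i hi => ?_, by simp⟩
  rcases Nat.lt_succ_iff_lt_or_eq.1 hi with hi | rfl
  · simpa [hi.le, Nat.succ_le_iff.2 hi] using hc i hi
  · simpa using hxy

/-- Finiteness makes `worldRank` a true maximum: chains to each world exist by well-founded
induction, and their lengths are bounded because they are injective. A longest chain to `x` then
extends to `y`. -/
theorem Interp.worldRank_lt_worldRank {W : Type u} [Finite W] {M : Interp W Atom}
    (hirrefl : ∀ x, ¬ M.lt x x) (htrans : ∀ x y z, M.lt x y → M.lt y z → M.lt x z) {x y : W}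
    (hxy : M.lt x y) : M.worldRank x < M.worldRank y := by
  have : Std.Irrefl M.lt := ⟨hirrefl⟩
  have : IsTrans W M.lt := ⟨htrans⟩
  have hne : ∀ x, ∃ n, M.IsChainLength x n := by
    intro x
    induction x using (Finite.wellFounded_of_trans_of_irrefl M.lt).induction with
    | _ x ih =>
      by_cases hx : ∃ z, M.lt z x
      · obtain ⟨z, hz⟩ := hx
        obtain ⟨n, hn⟩ := ih z hz
        exact ⟨n + 1, hn.succ hz⟩
      · exact ⟨0, fun _ => x, not_exists.1 hx, by simp, rfl⟩
  have hbdd : ∀ x, BddAbove {n | M.IsChainLength x n} := by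
    intro x
    refine ⟨Nat.card W, ?_⟩
    rintro n ⟨c, -, hc, -⟩
    have hlt : ∀ j ≤ n, ∀ i < j, M.lt (c i) (c j) := by
      intro j
      induction j with
      | zero => simp
      | succ j ih =>
        intro hj i hi
        rcases Nat.lt_succ_iff_lt_or_eq.1 hi with hi | rfl
        · exact htrans _ _ _ (ih (by omega) i hi) (hc j hj)
        · exact hc i hj
    have hinj : Function.Injective fun i : Fin n => c i := by
      intro i j hij
      rcases lt_trichotomy i j with h | h | h
      · exact (hirrefl _ (Eq.subst (motive := M.lt (c i)) hij.symm (hlt j j.2.le i h))).elim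
      · exact h
      · exact (hirrefl _ (Eq.subst (motive := M.lt (c j)) hij (hlt i i.2.le j h))).elim
    simpa using Nat.card_le_card_of_injective _ hinj
  have hx : M.IsChainLength x (M.worldRank x) := Nat.sSup_mem (hne x) (hbdd x)
  exact Nat.lt_of_succ_le (le_csSup (hbdd y) (hx.succ hxy))

/-! ### The seriousness ordering -/

theorem TupleLT.irrefl {α : Type u} (X : ℕ → Set α) (n : ℕ) : ¬ TupleLT X X n := by
  induction n with
  | zero => exact ssubset_irrefl (X 0)
  | succ n ih => rintro (h | ⟨-, h⟩); exacts [ssubset_irrefl _ h, ih h]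

theorem TupleLT.trans {α : Type u} {X Y Z : ℕ → Set α} {n : ℕ} (hXY : TupleLT X Y n)
    (hYZ : TupleLT Y Z n) : TupleLT X Z n := by
  induction n with
  | zero => exact ssubset_trans hXY hYZ
  | succ n ih =>
    rcases hXY with h₁ | ⟨h₁, h₁'⟩ <;> rcases hYZ with h₂ | ⟨h₂, h₂'⟩
    · exact Or.inl (h₁.trans h₂)
    · exact Or.inl (h₂ ▸ h₁)
    · exact Or.inl (h₁ ▸ h₂)
    · exact Or.inr ⟨h₁.trans h₂, ih h₁' h₂'⟩

theorem TupleLT.trans_le {α : Type u} {X Y Z : ℕ → Set α} {n : ℕ} (hXY : TupleLT X Y n)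
    (hYZ : ∀ i, Y i ⊆ Z i) : TupleLT X Z n := by
  induction n with
  | zero => exact ssubset_of_ssubset_of_subset hXY (hYZ 0)
  | succ n ih =>
    rcases hXY with h | ⟨h, h'⟩
    · exact Or.inl (ssubset_of_ssubset_of_subset h (hYZ _))
    · rcases (hYZ (n + 1)).eq_or_ssubset with e | e
      · exact Or.inr ⟨h.trans e, ih h'⟩
      · exact Or.inl (h ▸ e)

/-- Taking complements inside a common tuple `Z` reverses the order; this passes from satisfied
defaults to violated ones. -/
theorem TupleLT.of_sdiff {α : Type u} {X Y Z : ℕ → Set α} {n : ℕ} (hX : ∀ i, X i ⊆ Z i)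
    (hY : ∀ i, Y i ⊆ Z i) (h : TupleLT (fun i => Z i \ X i) (fun i => Z i \ Y i) n) :
    TupleLT Y X n := by
  have hss : ∀ i, Z i \ X i ⊂ Z i \ Y i → Y i ⊂ X i := fun i h => by
    refine ⟨fun a ha => ?_, fun hXY => h.2 (Set.sdiff_subset_sdiff_right hXY)⟩
    by_contra haX
    exact (h.1 ⟨hY i ha, haX⟩).2 ha
  induction n with
  | zero => exact hss 0 h
  | succ n ih =>
    rcases h with h | ⟨h, h'⟩
    · exact Or.inl (hss _ h)
    · refine Or.inr ⟨?_, ih h'⟩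
      rw [← Set.sdiff_sdiff_cancel_left (hX (n + 1)), ← Set.sdiff_sdiff_cancel_left (hY (n + 1))]
      exact congrArg _ h.symm

theorem MPLT.irrefl (K D : Set (Conditional Atom)) : ¬ MPLT K D D := by
  rintro (h | ⟨-, h⟩)
  exacts [ssubset_irrefl _ h, TupleLT.irrefl _ _ h]

theorem MPLT.trans {K D E F : Set (Conditional Atom)} (h₁ : MPLT K D E) (h₂ : MPLT K E F) :
    MPLT K D F := by
  rcases h₁ with h₁ | ⟨h₁, h₁'⟩ <;> rcases h₂ with h₂ | ⟨h₂, h₂'⟩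
  · exact Or.inl (h₁.trans h₂)
  · exact Or.inl (h₂ ▸ h₁)
  · exact Or.inl (h₁ ▸ h₂)
  · exact Or.inr ⟨h₁.trans h₂, h₁'.trans h₂'⟩

theorem layer_mono {K D E : Set (Conditional Atom)} (h : D ⊆ E) (r : ℕ∞) :
    layer K D r ⊆ layer K E r := fun _ hc => ⟨h hc.1, hc.2⟩

theorem layer_sdiff (K D E : Set (Conditional Atom)) (r : ℕ∞) :
    layer K (D \ E) r = layer K D r \ layer K E r := by
  ext c
  simp only [layer, Set.mem_ofPred_eq, Set.mem_sdiff]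
  tauto

/-! ### MP-models -/

section MPModel

variable {W : Type u}

theorem mpFunctor_worldRank_lt [Finite W] {K : Set (Conditional Atom)} {M : Interp W Atom} {x y : W}
    (h : MPLT K (violated K M x) (violated K M y)) :
    (mpFunctor K M).worldRank x < (mpFunctor K M).worldRank y :=
  Interp.worldRank_lt_worldRank (fun _ => MPLT.irrefl K _) (fun _ _ _ => MPLT.trans) h

theorem satMaterial_sdiff_violated {K : Set (Conditional Atom)} {M : Interp W Atom} {w : W} :
    SatMaterial (M.v w) (K \ violated K M w) := fun _ hc hA =>
  by_contra fun h => hc.2 ⟨hc.1, hA, h⟩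

/-- The rationality properties of the relation defined by a ranked model. -/
theorem Interp.IsRanked.isRationalRel {M : Interp W Atom} (hM : M.IsRanked) (S : Set Atom) :
    IsRationalRel S (conseqRel S M) where
  subset_lang _ hc := hc.1
  leftLogicalEquivalence A _ B hB C hC hAB h := by
    have hiff : ∀ w, M.Sat w B ↔ M.Sat w A := fun w => ⟨(hAB (M.v w)).2, (hAB (M.v w)).1⟩
    refine ⟨⟨hB, hC⟩, fun w hw => h.2 w ⟨(hiff w).1 hw.1, fun w' hlt hw' => ?_⟩⟩
    exact hw.2 w' hlt ((hiff w').2 hw')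
  rightWeakening A hA B _ C hC hBC h := ⟨⟨hA, hC⟩, fun w hw => hBC _ (h.2 w hw)⟩
  reflexivity A hA := ⟨⟨hA, hA⟩, fun _ hw => hw.1⟩
  andRule A hA B hB C hC h₁ h₂ :=
    ⟨⟨hA, Set.union_subset hB hC⟩, fun w hw => ⟨h₁.2 w hw, h₂.2 w hw⟩⟩
  orRule A hA B hB C hC h₁ h₂ := by
    refine ⟨⟨Set.union_subset hA hB, hC⟩, fun w hw => ?_⟩
    rcases hw.1 with h | h
    · exact h₁.2 w ⟨h, fun w' hlt hw' => hw.2 w' hlt (Or.inl hw')⟩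
    · exact h₂.2 w ⟨h, fun w' hlt hw' => hw.2 w' hlt (Or.inr hw')⟩
  cautiousMonotonicity A hA B hB C hC h₁ h₂ := by
    refine ⟨⟨Set.union_subset hA hB, hC⟩, fun w hw => h₂.2 w ?_⟩
    rcases hM.smooth A w hw.1.1 with h | ⟨w', hw', hlt⟩
    · exact h
    · exact (hw.2 w' hlt ⟨hw'.1, h₁.2 w' hw'⟩).elim
  rationalMonotonicity A hA B hB C hC h₁ h₂ := by
    refine ⟨⟨Set.union_subset hA hB, hC⟩, fun w hw => h₁.2 w ⟨hw.1.1, fun w' hlt hw' => ?_⟩⟩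
    refine h₂ ⟨⟨hA, hB⟩, fun m hm hmB => ?_⟩
    -- Modularity places `m` above `w'`, against its minimality for `A`, or below `w`, against the
    -- minimality of `w` for `A ∧ B`.
    rcases hM.modular w' w m hlt with h | h
    · exact hm.2 w' h hw'
    · exact hw.2 m h ⟨hm.1, hmB⟩

theorem Interp.rankify_isRanked [Nonempty W] (N : Interp W Atom) : N.rankify.IsRanked :=
  Interp.isRanked_of_lt_iff N.worldRank fun _ _ => Iff.rfl

/-- The relation defined by an MP-model extends the MP-closure. -/
theorem mpClosure_subset_mpRational {K : Set (Conditional Atom)} {S : Set Atom} (hK : K.Finite)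
    (hKS : K ⊆ CondLang S) {N : Interp W Atom} (hN : IsMPModel K S N) :
    mpClosure K S ⊆ mpRational S N := by
  obtain ⟨M, ⟨hW, ⟨hM, hMK, hcan⟩, -⟩, rfl⟩ := hN
  rintro c ⟨hcS, hc⟩
  refine ⟨hcS, fun w hw => ?_⟩
  obtain ⟨hwA, hmin⟩ := hw
  replace hwA : c.ante.Holds (M.v w) := hwA
  obtain ⟨i, hi⟩ := (compatible_v (S := S) hM.toIsPreferential hMK w).exists_satMaterial hK hKS
  have hsatw : ∀ B ∈ insert c.ante (material (K \ violated K M w)), B.Holds (M.v w) := by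
    rintro B (rfl | hB)
    · exact hwA
    · exact satMaterial_iff_material.1 satMaterial_sdiff_violated B hB
  -- The defaults not violated at `w` are claimed to form an MP-basis; only maximality remains to be
  -- shown.
  refine hc (K \ violated K M w) ⟨rank_ne_top hi hwA, Set.sdiff_subset, ⟨_, hsatw⟩, ?_⟩ _ hsatw
  rintro ⟨B, hBK, ⟨s, hs⟩, hlt⟩
  have hsA : c.ante.Holds s := hs _ (Set.mem_insert _ _)
  have hsB : SatMaterial s B :=
    satMaterial_iff_material.2 fun A hA => hs A (Set.mem_insert_of_mem _ hA)
  have hwtop : layer K (violated K M w) ⊤ = ∅ := by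
    refine Set.eq_empty_of_forall_notMem fun d hd => hd.1.2.2 ?_
    exact hi d (mem_excSeq_of_rank_eq_top hd.1.1 hd.2 i) hd.1.2.1
  -- `w` violates no default of infinite rank, so a more serious `B` must contain them all.
  have hKB : layer K K ⊤ ⊆ layer K B ⊤ := by
    have h : layer K (K \ violated K M w) ⊤ ⊆ layer K B ⊤ := by
      rcases hlt with h | ⟨h, -⟩
      exacts [h.subset, h.subset]
    rwa [layer_sdiff, hwtop, Set.sdiff_empty] at h
  obtain ⟨n, hn⟩ := exists_excSeq_subset_layer_top hK
  -- Hence `s` has finite rank, is compatible, and is realized at a world by canonicity.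
  have hsn : SatMaterial s (excSeq K n) := hsB.mono fun d hd => (hKB (hn hd)).1
  obtain ⟨x, hx⟩ := hcan s (compatible_of_satMaterial hKS hsn)
  have hxB : B ⊆ K \ violated K M x := fun d hd =>
    ⟨hBK hd, fun hv => hv.2.2 ((hx _ (hKS (hBK hd)).2).2
      (hsB d hd ((hx _ (hKS (hBK hd)).1).1 hv.2.1)))⟩
  have hxtop : layer K (violated K M x) ⊤ = ∅ :=
    Set.eq_empty_of_forall_notMem fun d hd => (hxB (hKB ⟨hd.1.1, hd.2⟩).1).2 hd.1
  refine hmin x (mpFunctor_worldRank_lt (Or.inr ⟨hxtop.trans hwtop.symm, ?_⟩))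
    ((hx _ hcS.1).2 hsA)
  have htuple : TupleLT (fun i => layer K (K \ violated K M w) (i : ℕ∞))
      (fun i => layer K (K \ violated K M x) (i : ℕ∞)) (order K) := by
    rcases hlt with h | ⟨-, h⟩
    · refine (h.2 (layer_mono hBK _ |>.trans ?_)).elim
      rw [layer_sdiff, hwtop, Set.sdiff_empty]
    · exact h.trans_le fun i => layer_mono hxB _
  simp only [layer_sdiff] at htuple
  exact TupleLT.of_sdiff (Z := fun i => layer K K (i : ℕ∞))
    (fun i => layer_mono (fun _ h => h.1) _) (fun i => layer_mono (fun _ h => h.1) _) htuple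

end MPModel

/-! ### Independence of the MP-model -/

section Independence

variable {W₁ W₂ : Type u} {K : Set (Conditional Atom)} {S : Set Atom}

theorem violated_congr (hKS : K ⊆ CondLang S) {M₁ : Interp W₁ Atom} {M₂ : Interp W₂ Atom}
    {x : W₁} {y : W₂} (h : ∀ B ∈ Lang S, M₁.Sat x B ↔ M₂.Sat y B) :
    violated K M₁ x = violated K M₂ y := by
  ext c
  refine and_congr_right fun hc => ?_
  exact and_congr (h _ (hKS hc).1) (not_congr (h _ (hKS hc).2))

theorem IsCanonicalRanked.exists_agree {M₁ : Interp W₁ Atom} {M₂ : Interp W₂ Atom}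
    (h₁ : IsCanonicalRanked K S M₁) (h₂ : IsCanonicalRanked K S M₂) (x : W₁) :
    ∃ y : W₂, ∀ B ∈ Lang S, M₁.Sat x B ↔ M₂.Sat y B := by
  obtain ⟨y, hy⟩ := h₂.2.2 _ (compatible_v h₁.1.toIsPreferential h₁.2.1 x)
  exact ⟨y, fun B hB => (hy B hB).symm⟩

/-- Replacing each world of a chain by one agreeing with it on `Lang S` keeps the violated sets,
hence the order. The start stays minimal because a world below it would have a counterpart below the
original start. -/
theorem isChainLength_of_agree (hKS : K ⊆ CondLang S) {M₁ : Interp W₁ Atom} {M₂ : Interp W₂ Atom}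
    (h₁ : IsCanonicalRanked K S M₁) (h₂ : IsCanonicalRanked K S M₂) {x : W₁} {y : W₂}
    (hxy : ∀ B ∈ Lang S, M₁.Sat x B ↔ M₂.Sat y B) {n : ℕ}
    (hn : (mpFunctor K M₁).IsChainLength x n) : (mpFunctor K M₂).IsChainLength y n := by
  classical
  choose f hf using h₁.exists_agree h₂
  obtain ⟨c, h0, hc, rfl⟩ := hn
  -- The endpoint must be `y` itself, whereas `f` may choose another world agreeing with `x`.
  let c' : ℕ → W₂ := fun i => if i = n then y else f (c i)
  have hc' : ∀ i, violated K M₂ (c' i) = violated K M₁ (c i) := by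
    intro i
    by_cases hi : i = n
    · subst hi
      simpa [c'] using (violated_congr hKS hxy).symm
    · simpa [c', hi] using (violated_congr hKS (hf (c i))).symm
  refine ⟨c', fun z hz => ?_, fun i hi => ?_, by simp [c']⟩
  · obtain ⟨z', hz'⟩ := h₂.exists_agree h₁ z
    refine h0 z' ?_
    change MPLT K _ _ at hz
    change MPLT K _ _
    rwa [← hc', ← violated_congr hKS hz']
  · change MPLT K _ _
    rw [hc', hc']
    exact hc i hi

theorem worldRank_eq_of_agree (hKS : K ⊆ CondLang S) {M₁ : Interp W₁ Atom} {M₂ : Interp W₂ Atom}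
    (h₁ : IsCanonicalRanked K S M₁) (h₂ : IsCanonicalRanked K S M₂) {x : W₁} {y : W₂}
    (hxy : ∀ B ∈ Lang S, M₁.Sat x B ↔ M₂.Sat y B) :
    (mpFunctor K M₁).worldRank x = (mpFunctor K M₂).worldRank y :=
  congrArg sSup <| Set.ext fun _ =>
    ⟨isChainLength_of_agree hKS h₁ h₂ hxy,
      isChainLength_of_agree hKS h₂ h₁ fun B hB => (hxy B hB).symm⟩

theorem mpRational_subset (hKS : K ⊆ CondLang S) {N₁ : Interp W₁ Atom} {N₂ : Interp W₂ Atom}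
    (hN₁ : IsMPModel K S N₁) (hN₂ : IsMPModel K S N₂) : mpRational S N₁ ⊆ mpRational S N₂ := by
  obtain ⟨M₁, ⟨-, h₁, -⟩, rfl⟩ := hN₁
  obtain ⟨M₂, ⟨-, h₂, -⟩, rfl⟩ := hN₂
  rintro c ⟨hcS, hc⟩
  refine ⟨hcS, fun y hy => ?_⟩
  obtain ⟨x, hx⟩ := h₂.exists_agree h₁ y
  refine (hx _ hcS.2).2 (hc x ⟨(hx _ hcS.1).1 hy.1, fun x' hlt hx' => ?_⟩)
  obtain ⟨y', hy'⟩ := h₁.exists_agree h₂ x'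
  refine hy.2 y' ?_ ((hy' _ hcS.1).1 hx')
  change (mpFunctor K M₂).worldRank y' < (mpFunctor K M₂).worldRank y
  rw [worldRank_eq_of_agree hKS h₂ h₁ hx, ← worldRank_eq_of_agree hKS h₁ h₂ hy']
  exact hlt

end Independence

/-! ### Unconditional defaults -/

theorem TupleLT_iff_of_eq_empty {α : Type u} {X Y : ℕ → Set α} (hX : ∀ i, X (i + 1) = ∅)
    (hY : ∀ i, Y (i + 1) = ∅) (n : ℕ) : TupleLT X Y n ↔ X 0 ⊂ Y 0 := by
  induction n with
  | zero => exact Iff.rfl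
  | succ n ih => simp [TupleLT, hX, hY, ih]

/-- If all defaults have rank zero, seriousness is strict inclusion. -/
theorem MPLT_iff_ssubset {K D E : Set (Conditional Atom)} (hK : ∀ c ∈ K, rank K c.ante = 0)
    (hD : D ⊆ K) (hE : E ⊆ K) : MPLT K D E ↔ D ⊂ E := by
  have hzero : ∀ F ⊆ K, layer K F 0 = F := fun F hF =>
    Set.ext fun c => ⟨fun h => h.1, fun h => ⟨h, hK c (hF h)⟩⟩
  have hpos : ∀ F ⊆ K, ∀ r : ℕ∞, r ≠ 0 → layer K F r = ∅ := fun F hF r hr =>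
    Set.eq_empty_of_forall_notMem fun c hc => hr (hc.2.symm.trans (hK c (hF hc.1)))
  have hsucc : ∀ F ⊆ K, ∀ i : ℕ, layer K F ((i + 1 : ℕ) : ℕ∞) = ∅ := fun F hF i =>
    hpos F hF _ (by simp)
  rw [MPLT, hpos D hD ⊤ (by simp), hpos E hE ⊤ (by simp),
    TupleLT_iff_of_eq_empty (hsucc D hD) (hsucc E hE)]
  simp [hzero D hD, hzero E hE]

theorem rank_eq_zero {K : Set (Conditional Atom)} {A : Formula Atom} {s : Set Atom}
    (hs : SatMaterial s K) (hA : A.Holds s) : rank K A = 0 :=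
  nonpos_iff_eq_zero.1 (sInf_le ⟨0, not_exceptional_iff.2 ⟨s, hs, hA⟩, rfl⟩)

end

/-! ### Three independent defaults -/

/-- The default that the atom `i` is normally true. -/
def atomDefault (i : Fin 3) : Conditional (Fin 3) := ⟨.top, .atom i⟩

/-- Each of three atoms is normally true. -/
def atomDefaults : Set (Conditional (Fin 3)) := Set.range atomDefault

/-- Either only the first of three atoms is false, or only the first is true. -/
def firstOdd : Formula (Fin 3) :=
  .or (.and (.neg (.atom 0)) (.and (.atom 1) (.atom 2)))
    (.and (.atom 0) (.and (.neg (.atom 1)) (.neg (.atom 2))))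

theorem atomDefault_injective : Function.Injective atomDefault := fun i j h => by
  simpa [atomDefault] using h

theorem satMaterial_atomDefaults : SatMaterial Set.univ atomDefaults := by
  rintro _ ⟨i, rfl⟩ -
  exact Set.mem_univ i

theorem rank_atomDefaults : ∀ c ∈ atomDefaults, rank atomDefaults c.ante = 0 := by
  rintro _ ⟨i, rfl⟩
  exact rank_eq_zero satMaterial_atomDefaults (by simp [atomDefault, top, Holds])

theorem rank_firstOdd_ne_top : rank atomDefaults firstOdd ≠ ⊤ := by
  -- Stage 1 is empty: `top` is not exceptional, since all three defaults hold at `Set.univ`.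
  refine rank_ne_top (s := {0}) (i := 1) (fun c hc _ => ?_) (by simp [firstOdd, Holds])
  refine (not_exceptional_iff.2 ⟨_, satMaterial_atomDefaults, ?_⟩ hc.2).elim
  obtain ⟨i, rfl⟩ := hc.1
  simp [atomDefault, top, Holds]

theorem atomDefaults_subset : atomDefaults ⊆ CondLang Set.univ := fun _ _ =>
  ⟨Set.subset_univ _, Set.subset_univ _⟩

theorem atomDefaults_satisfiable : Satisfiable atomDefaults := by
  refine ⟨PUnit, ⟨fun _ _ => False, fun _ => Set.univ⟩,
    (Interp.isRanked_of_lt_iff (fun _ => 0) fun _ _ => by simp).toIsPreferential, ?_⟩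
  exact fun c hc w hw => satMaterial_atomDefaults c hc hw.1

theorem violated_atomDefaults {W : Type} (M : Interp W (Fin 3)) (w : W) :
    violated atomDefaults M w = atomDefault '' (M.v w)ᶜ := by
  ext c
  constructor
  · rintro ⟨⟨i, rfl⟩, -, h⟩
    exact ⟨i, h, rfl⟩
  · rintro ⟨i, hi, rfl⟩
    exact ⟨⟨i, rfl⟩, not_false, hi⟩

theorem mpFunctor_atomDefaults_lt_iff {W : Type} {M : Interp W (Fin 3)} {x y : W} :
    (mpFunctor atomDefaults M).lt x y ↔ M.v y ⊂ M.v x := by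
  change MPLT _ _ _ ↔ _
  rw [MPLT_iff_ssubset rank_atomDefaults (fun _ h => h.1) (fun _ h => h.1),
    violated_atomDefaults, violated_atomDefaults, ssubset_iff_subset_not_subset,
    Set.image_subset_image_iff atomDefault_injective,
    Set.image_subset_image_iff atomDefault_injective, Set.compl_subset_compl,
    Set.compl_subset_compl, ssubset_iff_subset_not_subset]

theorem exists_v_eq {W : Type} {M : Interp W (Fin 3)}
    (hM : IsCanonicalRanked atomDefaults Set.univ M) (s : Set (Fin 3)) : ∃ w, M.v w = s := by
  have hs : Compatible atomDefaults Set.univ s := by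
    refine compatible_of_satMaterial (i := 1) atomDefaults_subset fun c hc _ => ?_
    refine (not_exceptional_iff.2 ⟨_, satMaterial_atomDefaults, ?_⟩ hc.2).elim
    obtain ⟨i, rfl⟩ := hc.1
    simp [atomDefault, top, Holds]
  obtain ⟨w, hw⟩ := hM.2.2 s hs
  exact ⟨w, Set.ext fun i => hw (.atom i) (Set.subset_univ _)⟩

/-- A world strictly below makes a proper subset of `{0}` false, so it makes every atom true and
nothing lies below it. -/
theorem worldRank_le_one {W : Type} {M : Interp W (Fin 3)} {x : W} (hx : M.v x = {0}ᶜ) :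
    (mpFunctor atomDefaults M).worldRank x ≤ 1 := by
  refine csSup_le' ?_
  rintro n ⟨c, -, hc, rfl⟩
  by_contra! hn
  obtain ⟨m, rfl⟩ : ∃ m, n = m + 2 := ⟨n - 2, by omega⟩
  have h₁ := mpFunctor_atomDefaults_lt_iff.1 (hc m (by omega))
  have h₂ := mpFunctor_atomDefaults_lt_iff.1 (hc (m + 1) (by omega))
  rw [hx, ← compl_lt_compl_iff_lt, compl_compl] at h₂
  have h₃ := Set.ssubset_singleton_iff.1 h₂
  rw [Set.compl_empty_iff.1 h₃] at h₁
  exact h₁.2 (Set.subset_univ _)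

/-- The bound comes from the chain of worlds with valuations `Set.univ`, `{0, 1}`, `{0}`. -/
theorem two_le_worldRank {W : Type} {M : Interp W (Fin 3)}
    (hM : IsMinRC atomDefaults Set.univ M) {y : W} (hy : M.v y = {0}) :
    2 ≤ (mpFunctor atomDefaults M).worldRank y := by
  have := hM.1
  obtain ⟨x₀, h₀⟩ := exists_v_eq hM.2.1 Set.univ
  obtain ⟨x₁, h₁⟩ := exists_v_eq hM.2.1 {0, 1}
  have h₀₁ : (mpFunctor atomDefaults M).lt x₀ x₁ := by
    rw [mpFunctor_atomDefaults_lt_iff, h₀, h₁, Set.ssubset_univ_iff]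
    intro h
    have : (2 : Fin 3) ∈ ({0, 1} : Set (Fin 3)) := h ▸ Set.mem_univ _
    simp at this
  have h₁y : (mpFunctor atomDefaults M).lt x₁ y := by
    rw [mpFunctor_atomDefaults_lt_iff, h₁, hy]
    refine ⟨by simp, fun h => ?_⟩
    have : (1 : Fin 3) ∈ ({0} : Set (Fin 3)) := h (by simp)
    simp at this
  have := mpFunctor_worldRank_lt h₀₁
  have := mpFunctor_worldRank_lt h₁y
  omega

theorem firstOdd_mem_mpRational {W : Type} {N : Interp W (Fin 3)}
    (hN : IsMPModel atomDefaults Set.univ N) :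
    ⟨firstOdd, .atom 1⟩ ∈ mpRational Set.univ N := by
  obtain ⟨M, hM, rfl⟩ := hN
  refine ⟨⟨Set.subset_univ _, Set.subset_univ _⟩, fun w hw => ?_⟩
  rcases hw.1 with h | ⟨h0, h1, h2⟩
  · exact h.2.1
  · have hv : M.v w = {0} := by
      ext i
      fin_cases i
      exacts [iff_of_true h0 rfl, iff_of_false h1 (by simp), iff_of_false h2 (by simp)]
    obtain ⟨x, hx⟩ := exists_v_eq hM.2.1 {0}ᶜ
    refine (hw.2 x ?_ (Or.inl ?_)).elim
    · exact lt_of_le_of_lt (worldRank_le_one hx) (two_le_worldRank hM hv)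
    · change _ ∉ M.v x ∧ _ ∈ M.v x ∧ _ ∈ M.v x
      simp [hx]

/-- Any larger set still contains the default for atom 0; with atom 0 true, `firstOdd` falsifies the
other two atoms and leaves no room for their defaults. -/
theorem isMPBasis_firstOdd : IsMPBasis atomDefaults firstOdd {atomDefault 0} := by
  have hsub : {atomDefault 0} ⊆ atomDefaults := Set.singleton_subset_iff.2 ⟨0, rfl⟩
  refine ⟨rank_firstOdd_ne_top, hsub, ⟨{0}, ?_⟩, ?_⟩
  · simp [material, firstOdd, atomDefault, Holds]
  · rintro ⟨B, hBK, ⟨s, hs⟩, hlt⟩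
    rw [MPLT_iff_ssubset rank_atomDefaults hsub hBK] at hlt
    have hsB : ∀ i, atomDefault i ∈ B → i ∈ s := fun i hi =>
      hs _ (Set.mem_insert_of_mem _ ⟨_, hi, rfl⟩) not_false
    have h0 : (0 : Fin 3) ∈ s := hsB 0 (hlt.1 rfl)
    rcases hs _ (Set.mem_insert _ _) with h | ⟨-, h1, h2⟩
    · exact h.1 h0
    · refine hlt.2 fun c hc => ?_
      obtain ⟨i, rfl⟩ := hBK hc
      have hi := hsB i hc
      fin_cases i
      exacts [rfl, (h1 hi).elim, (h2 hi).elim]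

theorem firstOdd_notMem_mpClosure : ⟨firstOdd, .atom 1⟩ ∉ mpClosure atomDefaults Set.univ := by
  rintro ⟨-, h⟩
  have := h _ isMPBasis_firstOdd {0} (by simp [material, firstOdd, atomDefault, Holds])
  simp [Holds] at this

end KLM

theorem proposition12 :
    (∀ (Atom : Type u) (S : Set Atom) (K : Set (KLM.Conditional Atom)),
      S.Finite → K.Finite → K ⊆ KLM.CondLang S → KLM.Satisfiable K →
        -- MP-models exist
        (∃ (W : Type u) (N : KLM.Interp W Atom), KLM.IsMPModel K S N) ∧
        -- the relation defined by the ranked model is independent of the chosen MP-model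
        (∀ (W₁ W₂ : Type u) (N₁ : KLM.Interp W₁ Atom) (N₂ : KLM.Interp W₂ Atom),
          KLM.IsMPModel K S N₁ → KLM.IsMPModel K S N₂ →
            KLM.mpRational S N₁ = KLM.mpRational S N₂) ∧
        -- it is defined by a ranked model, is rational and contains the MP-closure
        (∀ (W : Type u) (N : KLM.Interp W Atom), KLM.IsMPModel K S N →
          N.rankify.IsRanked ∧ KLM.IsRationalRel S (KLM.mpRational S N) ∧
            KLM.mpClosure K S ⊆ KLM.mpRational S N)) ∧
    -- the inclusion can be strict
    (∃ (Atom : Type) (S : Set Atom) (K : Set (KLM.Conditional Atom)),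
      S.Finite ∧ K.Finite ∧ K ⊆ KLM.CondLang S ∧ KLM.Satisfiable K ∧
        ∀ (W : Type) (N : KLM.Interp W Atom), KLM.IsMPModel K S N →
          KLM.mpClosure K S ⊂ KLM.mpRational S N) := by
  refine ⟨fun Atom S K hS hK hKS hsat => ⟨KLM.exists_isMPModel hS hK hKS hsat, ?_, ?_⟩, ?_⟩
  · exact fun W₁ W₂ N₁ N₂ h₁ h₂ =>
      (KLM.mpRational_subset hKS h₁ h₂).antisymm (KLM.mpRational_subset hKS h₂ h₁)
  · intro W N hN
    have : Nonempty W := by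
      obtain ⟨M, hM, -⟩ := hN
      exact hM.2.1.1.nonempty
    exact ⟨N.rankify_isRanked, N.rankify_isRanked.isRationalRel S,
      KLM.mpClosure_subset_mpRational hK hKS hN⟩
  · refine ⟨Fin 3, Set.univ, KLM.atomDefaults, Set.finite_univ, Set.finite_range _,
      KLM.atomDefaults_subset, KLM.atomDefaults_satisfiable, fun W N hN => ?_⟩
    refine ⟨KLM.mpClosure_subset_mpRational (Set.finite_range _) KLM.atomDefaults_subset hN,
      fun h => ?_⟩
    exact KLM.firstOdd_notMem_mpClosure (h (KLM.firstOdd_mem_mpRational hN))
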